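/- Let $G$ be a locally compact Polish group, let $X$ be a standard Borel space (a measurable space whose $\sigma$-algebra is the Borel $\sigma$-algebra of some Polish topology on $X$), and let $\lambda$ be a $\sigma$-finite measure on $X$. Let $\alpha: G\times X\to X$ be a spatial measure-preserving action, that is, an action map which is Borel (measurable for the product $\sigma$-algebra on $G\times X$) and such that $\lambda(\alpha(g,\cdot)^{-1}(A))=\lambda(A)$ for every $g\in G$ and every measurable $A\subseteq X$. Then there exist a locally compact Polish space $Y$, a continuous action $\beta: G\times Y\to Y$ and a Borel injection $\theta: X\to Y$, defined on all of $X$, such that \[ \theta(\alpha(g,x))=\beta(g,\theta(x))\qquad\text{for all } g\in G \text{ and all } x\in X, \] such that the pushforward measure $\theta_*\lambda$ is a Radon measure on $Y$, and such that $\beta$ preserves $\theta_*\lambda$. Here a Borel measure $\eta$ on $Y$ is called Radon if $\eta(K)<\infty$ for every compact $K\subseteq Y$, if $\eta(U)=\sup\{\eta(K) : K\subseteq U \text{ compact}\}$ for every open $U\subseteq Y$, and if $\eta(A)=\inf\{\eta(U) : U\supseteq A \text{ open}\}$ for every Borel $A\subseteq Y$. -/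

import Mathlib

open MeasureTheory
universe u

open Filter Topology DomMulAct
open scoped ENNReal NNReal

/-! Fix an injective, bounded, nowhere zero, integrable `F : X → ℂ` and send `x` to the function `g
↦ F (g⁻¹ • x)`, viewed in `L^∞(G) ⊆ L¹(G)*`. Since `L¹(G)` is separable, a weak-* closed ball is
compact metrizable; without the origin it is locally compact Polish, and `G` acts on it continuously
because translation on `L¹(G)` is strongly continuous. The map is equivariant by left invariance of
Haar measure. Deleting the origin makes the pushforward locally finite
(`isLocallyFiniteMeasure_map_orbitMap`): near a nonzero functional some evaluation stays away from
`0`, and evaluations along the orbit map are integrable over `X`. -/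

/-- A σ-finite standard Borel space carries a bounded, integrable, nowhere vanishing, injective
measurable function. -/
theorem exists_injective_integrable_ne_zero {X : Type*} [MeasurableSpace X] [StandardBorelSpace X]
    (μ : Measure X) [SigmaFinite μ] :
    ∃ F : X → ℂ, Measurable F ∧ Function.Injective F ∧ (∀ x, F x ≠ 0) ∧ (∀ x, ‖F x‖ ≤ 3) ∧
      ∫⁻ x, ‖F x‖ₑ ∂μ ≠ ∞ := by
  obtain ⟨w, w_pos, w_meas, w_int⟩ := exists_pos_lintegral_lt_of_sigmaFinite μ one_ne_zero
  -- With `F = r + i r t`, the factor `r > 0` gives nonvanishing and integrability, and the ratio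
  -- `t` of the two parts determines the point. The bound is `3 = 1 + 2`, from `|t| ≤ 2`.
  set r : X → ℝ := fun x ↦ min (w x) 1 with hr
  set t : X → ℝ := fun x ↦ Real.arctan (embeddingReal X x) with ht
  have r_pos (x) : 0 < r x := lt_min (w_pos x) one_pos
  have r_meas : Measurable r := w_meas.coe_nnreal_real.min measurable_const
  have t_meas : Measurable t := Real.continuous_arctan.measurable.comp (measurable_embeddingReal X)
  have t_le (x) : |t x| ≤ 2 := by
    rw [abs_le]
    have h₁ := Real.neg_pi_div_two_lt_arctan (embeddingReal X x)
    have h₂ := Real.arctan_lt_pi_div_two (embeddingReal X x)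
    have h₃ := Real.pi_lt_four
    constructor <;> simp only [ht] <;> linarith
  have norm_le (x) : ‖(⟨r x, r x * t x⟩ : ℂ)‖ ≤ 3 * r x := by
    refine (Complex.norm_le_abs_re_add_abs_im _).trans ?_
    rw [abs_mul, abs_of_pos (r_pos x)]
    nlinarith [r_pos x, t_le x]
  refine ⟨fun x ↦ ⟨r x, r x * t x⟩, ?_, ?_, ?_, ?_, ?_⟩
  · exact Complex.measurableEquivRealProd.symm.measurable.comp (r_meas.prodMk (r_meas.mul t_meas))
  · intro x y hxy
    obtain ⟨h₁, h₂⟩ := Complex.mk.inj hxy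
    rw [h₁] at h₂
    exact (measurableEmbedding_embeddingReal X).injective
      (Real.arctan_injective (mul_left_cancel₀ (r_pos y).ne' h₂))
  · intro x hx
    exact (r_pos x).ne' (congrArg Complex.re hx)
  · intro x
    have : r x ≤ 1 := min_le_right _ _
    linarith [norm_le x]
  · have key (x) : ‖(⟨r x, r x * t x⟩ : ℂ)‖ₑ ≤ 3 * (w x : ℝ≥0∞) := by
      have h : ‖(⟨r x, r x * t x⟩ : ℂ)‖₊ ≤ 3 * w x := by
        rw [← NNReal.coe_le_coe]
        have : r x ≤ w x := min_le_left _ _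
        simpa using (norm_le x).trans (by linarith)
      rw [enorm_eq_nnnorm]
      exact_mod_cast h
    refine ne_top_of_le_ne_top ?_ (lintegral_mono key)
    rw [lintegral_const_mul _ w_meas.coe_nnreal_ennreal]
    exact ENNReal.mul_ne_top (by simp) (w_int.trans ENNReal.one_lt_top).ne

/-- A bounded measurable function annihilated by all of `L¹` vanishes almost everywhere. -/
theorem ae_eq_zero_of_forall_integral_Lp_mul_eq_zero {α : Type*} [MeasurableSpace α]
    {ν : Measure α} [SigmaFinite ν] {b : α → ℂ} (b_meas : Measurable b) {C : ℝ}
    (b_le : ∀ a, ‖b a‖ ≤ C) (h : ∀ k : Lp ℂ 1 ν, ∫ a, k a * b a ∂ν = 0) : b =ᵐ[ν] 0 := by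
  refine ae_eq_zero_of_forall_setIntegral_eq_of_sigmaFinite (fun s _ hνs ↦ ?_) fun s hs hνs ↦ ?_
  · exact Measure.integrableOn_of_bounded hνs.ne b_meas.aestronglyMeasurable
      (ae_of_all _ b_le)
  · rw [← h (indicatorConstLp 1 hs hνs.ne 1), ← integral_indicator hs]
    refine integral_congr_ae ?_
    filter_upwards [indicatorConstLp_coeFn (p := 1) (hs := hs) (hμs := hνs.ne) (c := (1 : ℂ))]
      with a ha
    by_cases has : a ∈ s <;> simp [ha, has]

theorem norm_smul_of_isIsometricSMul {M E : Type*} [Monoid M] [NormedAddCommGroup E]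
    [DistribMulAction M E] [IsIsometricSMul M E] (g : M) (k : E) : ‖g • k‖ = ‖k‖ := by
  rw [← dist_zero_right, ← dist_zero_right, ← dist_smul g k 0, smul_zero]

/-! ### The punctured ball of the dual -/

section PuncturedBall

variable (E : Type*) [NormedAddCommGroup E] [NormedSpace ℂ E]

/-- The closed ball of radius `3` in the dual of `E`, with the weak-* topology. -/
abbrev WeakDualBall : Type _ :=
  (WeakDual.toStrongDual ⁻¹' Metric.closedBall (0 : StrongDual ℂ E) 3 : Set (WeakDual ℂ E))

/-- The nonzero functionals of norm at most `3` on `E`, with the weak-* topology. -/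
abbrev PuncturedWeakDualBall : Type _ := ({φ | φ.1 ≠ 0} : Set (WeakDualBall E))

instance : CompactSpace (WeakDualBall E) :=
  isCompact_iff_compactSpace.mp (WeakDual.isCompact_closedBall _ _)

theorem isOpen_setOf_weakDualBall_ne_zero : IsOpen {φ : WeakDualBall E | φ.1 ≠ 0} :=
  isOpen_ne.preimage continuous_subtype_val

instance [TopologicalSpace.SeparableSpace E] : PolishSpace (WeakDualBall E) := by
  have := WeakDual.metrizable_of_isCompact ℂ E _
    (WeakDual.isCompact_closedBall (0 : StrongDual ℂ E) 3)
  let := TopologicalSpace.metrizableSpaceMetric (WeakDualBall E)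
  infer_instance

instance [TopologicalSpace.SeparableSpace E] : PolishSpace (PuncturedWeakDualBall E) :=
  (isOpen_setOf_weakDualBall_ne_zero E).polishSpace

instance : LocallyCompactSpace (PuncturedWeakDualBall E) :=
  (isOpen_setOf_weakDualBall_ne_zero E).locallyCompactSpace

variable {E}

theorem PuncturedWeakDualBall.continuous_eval (k : E) :
    Continuous fun φ : PuncturedWeakDualBall E ↦ φ.1.1 k :=
  (WeakDual.eval_continuous k).comp (continuous_subtype_val.comp continuous_subtype_val)

/-- Evaluation on a dense sequence is a continuous injection of Polish spaces, hence a Borel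
embedding by Lusin–Souslin. -/
theorem PuncturedWeakDualBall.measurable_of_eval [TopologicalSpace.SeparableSpace E]
    [MeasurableSpace (PuncturedWeakDualBall E)] [BorelSpace (PuncturedWeakDualBall E)]
    {X : Type*} [MeasurableSpace X] {f : X → PuncturedWeakDualBall E}
    (hf : ∀ k, Measurable fun x ↦ (f x).1.1 k) : Measurable f := by
  have emb : MeasurableEmbedding fun (φ : PuncturedWeakDualBall E) (n : ℕ) ↦
      φ.1.1 (TopologicalSpace.denseSeq E n) := by
    refine (continuous_pi fun n ↦ continuous_eval _).measurableEmbedding fun φ ψ h ↦ ?_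
    refine Subtype.ext (Subtype.ext (DFunLike.ext' ?_))
    exact Continuous.ext_on (TopologicalSpace.denseRange_denseSeq E) (map_continuous φ.1.1)
      (map_continuous ψ.1.1) (Set.eqOn_range.mpr h)
  exact emb.measurable_comp_iff.mp (measurable_pi_iff.mpr fun n ↦ hf _)

variable {G : Type*} [Group G] [DistribMulAction Gᵈᵐᵃ E] [SMulCommClass Gᵈᵐᵃ ℂ E]
  [IsIsometricSMul Gᵈᵐᵃ E]

/-- The functional `k ↦ φ (mk g • k)`. -/
noncomputable def WeakDual.domSMul (g : G) (φ : WeakDual ℂ E) : WeakDual ℂ E :=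
  StrongDual.toWeakDual ((WeakDual.toStrongDual φ).comp
    ⟨DistribSMul.toLinearMap ℂ E (mk g), (isometry_smul E (mk g)).continuous⟩)

theorem WeakDual.domSMul_mem {g : G} {φ : WeakDual ℂ E}
    (hφ : φ ∈ WeakDual.toStrongDual ⁻¹' Metric.closedBall (0 : StrongDual ℂ E) 3) :
    WeakDual.domSMul g φ ∈ WeakDual.toStrongDual ⁻¹' Metric.closedBall (0 : StrongDual ℂ E) 3 := by
  rw [Set.mem_preimage, mem_closedBall_zero_iff] at *
  refine ContinuousLinearMap.opNorm_le_bound _ (by norm_num) fun k ↦ ?_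
  refine ((WeakDual.toStrongDual φ).le_of_opNorm_le hφ (mk g • k)).trans_eq ?_
  rw [norm_smul_of_isIsometricSMul]

theorem WeakDual.domSMul_ne_zero {g : G} {φ : WeakDual ℂ E} (hφ : φ ≠ 0) :
    WeakDual.domSMul g φ ≠ 0 := by
  contrapose hφ
  refine DFunLike.ext _ _ fun k ↦ ?_
  have h : φ (mk g • (mk g)⁻¹ • k) = 0 := DFunLike.congr_fun hφ ((mk g)⁻¹ • k)
  rwa [smul_inv_smul] at h

/-- Precomposition reverses products, and so does `mk`; the result is a left action. -/
noncomputable instance : MulAction G (PuncturedWeakDualBall E) where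
  smul g φ := ⟨⟨WeakDual.domSMul g φ.1.1, WeakDual.domSMul_mem φ.1.2⟩,
    WeakDual.domSMul_ne_zero φ.2⟩
  one_smul φ := by
    refine Subtype.ext (Subtype.ext (DFunLike.ext _ _ fun k ↦ ?_))
    change φ.1.1 (mk (1 : G) • k) = _
    rw [mk_one, one_smul]
  mul_smul g h φ := by
    refine Subtype.ext (Subtype.ext (DFunLike.ext _ _ fun k ↦ ?_))
    change φ.1.1 (mk (g * h) • k) = φ.1.1 (mk h • mk g • k)
    rw [mk_mul, mul_smul]

theorem PuncturedWeakDualBall.smul_apply (g : G) (φ : PuncturedWeakDualBall E) (k : E) :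
    (g • φ).1.1 k = φ.1.1 (mk g • k) := rfl

instance [TopologicalSpace G] [ContinuousSMul Gᵈᵐᵃ E] :
    ContinuousSMul G (PuncturedWeakDualBall E) where
  continuous_smul := by
    refine Continuous.subtype_mk (Continuous.subtype_mk
      (WeakDual.continuous_of_continuous_eval fun k ↦ ?_) _) _
    refine continuous_iff_continuousAt.mpr fun ⟨g, φ⟩ ↦ ?_
    change Tendsto (fun p : G × PuncturedWeakDualBall E ↦ p.2.1.1 (mk p.1 • k)) _
      (𝓝 (φ.1.1 (mk g • k)))
    -- The uniform norm bound `3` turns norm continuity of `g ↦ mk g • k` into joint continuity.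
    have small : Tendsto (fun p : G × PuncturedWeakDualBall E ↦
        p.2.1.1 (mk p.1 • k - mk g • k)) (𝓝 (g, φ)) (𝓝 0) := by
      have orbit : Continuous fun p : G × PuncturedWeakDualBall E ↦
          3 * ‖mk p.1 • k - mk g • k‖ :=
        continuous_const.mul ((((continuous_mk.comp continuous_fst).smul
          continuous_const).sub continuous_const).norm)
      refine squeeze_zero_norm (fun p ↦ ?_) (by simpa using orbit.tendsto (g, φ))
      exact (WeakDual.toStrongDual p.2.1.1).le_of_opNorm_le
        (mem_closedBall_zero_iff.mp p.2.1.2) _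
    have main := ((PuncturedWeakDualBall.continuous_eval (mk g • k)).comp
      (continuous_snd (X := G))).tendsto (g, φ)
    simpa using small.add main

end PuncturedBall

/-! ### Functionals on `L¹` given by bounded functions -/

theorem integrable_Lp_mul {α : Type*} [MeasurableSpace α] {ν : Measure α} {b : α → ℂ}
    (b_meas : Measurable b) (b_le : ∀ a, ‖b a‖ ≤ 3) (k : Lp ℂ 1 ν) :
    Integrable (fun a ↦ k a * b a) ν :=
  (L1.integrable_coeFn k).mul_bdd b_meas.aestronglyMeasurable (ae_of_all _ b_le)

theorem norm_integral_Lp_mul_le {α : Type*} [MeasurableSpace α] {ν : Measure α} {b : α → ℂ}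
    (b_le : ∀ a, ‖b a‖ ≤ 3) (k : Lp ℂ 1 ν) : ‖∫ a, k a * b a ∂ν‖ ≤ 3 * ‖k‖ := by
  rw [L1.norm_eq_integral_norm, ← integral_const_mul]
  refine norm_integral_le_of_norm_le ((L1.integrable_coeFn k).norm.const_mul 3)
    (ae_of_all _ fun a ↦ ?_)
  rw [norm_mul, mul_comm]
  exact mul_le_mul_of_nonneg_right (b_le a) (norm_nonneg _)

/-- Integration against a measurable function bounded by `3`, as a functional on `L¹`. -/
noncomputable def integralMulLp {α : Type*} [MeasurableSpace α] (ν : Measure α) (b : α → ℂ)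
    (b_meas : Measurable b) (b_le : ∀ a, ‖b a‖ ≤ 3) : WeakDual ℂ (Lp ℂ 1 ν) :=
  StrongDual.toWeakDual <| LinearMap.mkContinuous
    { toFun := fun k ↦ ∫ a, k a * b a ∂ν
      map_add' := fun k l ↦ by
        rw [← integral_add (integrable_Lp_mul b_meas b_le k) (integrable_Lp_mul b_meas b_le l)]
        refine integral_congr_ae ?_
        filter_upwards [Lp.coeFn_add k l] with a ha
        rw [ha, Pi.add_apply, add_mul]
      map_smul' := fun c k ↦ by
        rw [RingHom.id_apply, ← integral_smul]
        refine integral_congr_ae ?_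
        filter_upwards [Lp.coeFn_smul c k] with a ha
        rw [ha, Pi.smul_apply, smul_mul_assoc] } 3 fun k ↦ norm_integral_Lp_mul_le b_le k

theorem integralMulLp_apply {α : Type*} [MeasurableSpace α] {ν : Measure α} {b : α → ℂ}
    (b_meas : Measurable b) (b_le : ∀ a, ‖b a‖ ≤ 3) (k : Lp ℂ 1 ν) :
    integralMulLp ν b b_meas b_le k = ∫ a, k a * b a ∂ν := rfl

theorem integralMulLp_mem {α : Type*} [MeasurableSpace α] {ν : Measure α} {b : α → ℂ}
    (b_meas : Measurable b) (b_le : ∀ a, ‖b a‖ ≤ 3) :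
    integralMulLp ν b b_meas b_le ∈
      WeakDual.toStrongDual ⁻¹' Metric.closedBall (0 : StrongDual ℂ (Lp ℂ 1 ν)) 3 := by
  rw [Set.mem_preimage, mem_closedBall_zero_iff]
  exact ContinuousLinearMap.opNorm_le_bound _ (by norm_num) (norm_integral_Lp_mul_le b_le)

theorem ae_eq_of_integralMulLp_eq {α : Type*} [MeasurableSpace α] {ν : Measure α} [SigmaFinite ν]
    {b c : α → ℂ} (b_meas : Measurable b) (b_le : ∀ a, ‖b a‖ ≤ 3) (c_meas : Measurable c)
    (c_le : ∀ a, ‖c a‖ ≤ 3)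
    (h : integralMulLp ν b b_meas b_le = integralMulLp ν c c_meas c_le) : b =ᵐ[ν] c := by
  have key : (b - c) =ᵐ[ν] 0 := by
    refine ae_eq_zero_of_forall_integral_Lp_mul_eq_zero (b_meas.sub c_meas) (C := 3 + 3)
      (fun a ↦ (norm_sub_le _ _).trans (add_le_add (b_le a) (c_le a))) fun k ↦ ?_
    have hk := DFunLike.congr_fun h k
    rw [integralMulLp_apply, integralMulLp_apply, ← sub_eq_zero, ← integral_sub] at hk
    · simpa only [Pi.sub_apply, mul_sub] using hk
    · exact integrable_Lp_mul b_meas b_le k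
    · exact integrable_Lp_mul c_meas c_le k
  filter_upwards [key] with a ha
  exact sub_eq_zero.mp ha

theorem integralMulLp_ne_zero {α : Type*} [MeasurableSpace α] {ν : Measure α} [SigmaFinite ν]
    [NeZero ν] {b : α → ℂ} (b_meas : Measurable b) (b_le : ∀ a, ‖b a‖ ≤ 3) (b_ne : ∀ a, b a ≠ 0) :
    integralMulLp ν b b_meas b_le ≠ 0 := by
  intro h
  obtain ⟨a, ha⟩ := (ae_eq_zero_of_forall_integral_Lp_mul_eq_zero b_meas b_le
    fun k ↦ DFunLike.congr_fun h k).exists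
  exact b_ne a ha

/-! ### The universal model -/

section Model

theorem measurable_comp_inv_smul {G X : Type*} [Group G] [MeasurableSpace G] [MeasurableInv G]
    [MeasurableSpace X] [MulAction G X] [MeasurableSMul₂ G X] {F : X → ℂ} (F_meas : Measurable F) :
    Measurable fun p : X × G ↦ F (p.2⁻¹ • p.1) :=
  F_meas.comp (measurable_snd.inv.smul measurable_fst)

variable {G : Type*} [Group G] [TopologicalSpace G] [IsTopologicalGroup G]
  [PolishSpace G] [LocallyCompactSpace G] [MeasurableSpace G] [BorelSpace G]
  {X : Type*} [MeasurableSpace X] [MulAction G X] [MeasurableSMul₂ G X]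

variable (G) in
/-- The nonzero elements of a weak-* compact ball of the dual of `L¹(G)`. -/
abbrev HaarModel : Type _ := PuncturedWeakDualBall (Lp ℂ 1 (Measure.haar : Measure G))

variable (G) in
/-- The map sending `x` to the class of `g ↦ F (g⁻¹ • x)` in the dual of `L¹(G)`. -/
noncomputable def orbitMap (F : X → ℂ) (F_meas : Measurable F) (F_le : ∀ x, ‖F x‖ ≤ 3)
    (F_ne : ∀ x, F x ≠ 0) (x : X) : HaarModel G :=
  have b_meas : Measurable fun g : G ↦ F (g⁻¹ • x) :=
    (measurable_comp_inv_smul F_meas).comp measurable_prodMk_left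
  ⟨⟨integralMulLp _ _ b_meas fun _ ↦ F_le _, integralMulLp_mem _ _⟩,
    integralMulLp_ne_zero b_meas (fun _ ↦ F_le _) fun _ ↦ F_ne _⟩

variable {F : X → ℂ} (F_meas : Measurable F) (F_le : ∀ x, ‖F x‖ ≤ 3) (F_ne : ∀ x, F x ≠ 0)

instance : TopologicalSpace.SeparableSpace (Lp ℂ 1 (Measure.haar : Measure G)) :=
  have : Fact ((1 : ℝ≥0∞) ≠ ∞) := ⟨ENNReal.one_ne_top⟩
  inferInstance

instance : ContinuousSMul Gᵈᵐᵃ (Lp ℂ 1 (Measure.haar : Measure G)) :=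
  have : Fact ((1 : ℝ≥0∞) ≠ ∞) := ⟨ENNReal.one_ne_top⟩
  inferInstance

theorem orbitMap_apply (x : X) (k : Lp ℂ 1 (Measure.haar : Measure G)) :
    (orbitMap G F F_meas F_le F_ne x).1.1 k = ∫ g, k g * F (g⁻¹ • x) ∂Measure.haar := rfl

theorem orbitMap_injective (F_inj : Function.Injective F) :
    Function.Injective (orbitMap G F F_meas F_le F_ne) := by
  intro x y hxy
  have b_meas (z : X) : Measurable fun g : G ↦ F (g⁻¹ • z) :=
    (measurable_comp_inv_smul F_meas).comp measurable_prodMk_left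
  -- Haar measure is nonzero, so an a.e. equality holds at some `g`.
  obtain ⟨g, hg⟩ := (ae_eq_of_integralMulLp_eq (b_meas x) (fun _ ↦ F_le _) (b_meas y) (fun _ ↦ F_le _)
    (congrArg (fun φ : HaarModel G ↦ φ.1.1) hxy)).exists
  exact smul_left_cancel _ (F_inj hg)

theorem orbitMap_smul (h : G) (x : X) :
    orbitMap G F F_meas F_le F_ne (h • x) = h • orbitMap G F F_meas F_le F_ne x := by
  refine Subtype.ext (Subtype.ext (DFunLike.ext _ _ fun k ↦ ?_))
  -- Substitute `h * g` for `g`: `(h * g)⁻¹ • h • x = g⁻¹ • x`.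
  rw [PuncturedWeakDualBall.smul_apply, orbitMap_apply, orbitMap_apply,
    ← integral_mul_left_eq_self _ h]
  refine integral_congr_ae ?_
  filter_upwards [smul_Lp_ae_eq (mk h) k] with g hg
  rw [hg, mk.symm_apply_apply, smul_eq_mul, mul_inv_rev, mul_smul, inv_smul_smul]

theorem measurable_orbitMap [MeasurableSpace (HaarModel G)] [BorelSpace (HaarModel G)] :
    Measurable (orbitMap G F F_meas F_le F_ne) := by
  refine PuncturedWeakDualBall.measurable_of_eval fun k ↦ ?_
  simp only [orbitMap_apply]
  refine (StronglyMeasurable.integral_prod_right (f := fun x g ↦ k g * F (g⁻¹ • x)) ?_).measurable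
  exact (((Lp.stronglyMeasurable k).measurable.comp measurable_snd).mul
    (measurable_comp_inv_smul F_meas)).stronglyMeasurable

/-- Tonelli and invariance of `μ` bound the integral by `‖k‖₁ ‖F‖₁`. -/
theorem lintegral_enorm_orbitMap_apply_ne_top {μ : Measure X} [SFinite μ]
    [SMulInvariantMeasure G X μ] (F_int : ∫⁻ x, ‖F x‖ₑ ∂μ ≠ ∞)
    (k : Lp ℂ 1 (Measure.haar : Measure G)) :
    ∫⁻ x, ‖(orbitMap G F F_meas F_le F_ne x).1.1 k‖ₑ ∂μ ≠ ∞ := by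
  have k_meas := (Lp.stronglyMeasurable k).measurable
  have le : ∫⁻ x, ‖(orbitMap G F F_meas F_le F_ne x).1.1 k‖ₑ ∂μ ≤
      ∫⁻ x, ∫⁻ g, ‖k g‖ₑ * ‖F (g⁻¹ • x)‖ₑ ∂Measure.haar ∂μ := by
    refine lintegral_mono fun x ↦ (enorm_integral_le_lintegral_enorm _).trans_eq ?_
    simp_rw [enorm_mul]
  refine ne_top_of_le_ne_top ?_ le
  rw [lintegral_lintegral_swap]
  · have inner (g : G) : ∫⁻ x, ‖k g‖ₑ * ‖F (g⁻¹ • x)‖ₑ ∂μ = ‖k g‖ₑ * ∫⁻ x, ‖F x‖ₑ ∂μ := by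
      have Fg_meas : Measurable fun x ↦ ‖F (g⁻¹ • x)‖ₑ :=
        (F_meas.comp (measurable_const_smul g⁻¹)).enorm
      rw [lintegral_const_mul _ Fg_meas,
        (measurePreserving_smul g⁻¹ μ).lintegral_comp F_meas.enorm]
    simp_rw [inner]
    rw [lintegral_mul_const _ k_meas.enorm]
    exact ENNReal.mul_ne_top (L1.integrable_coeFn k).2.ne F_int
  · exact ((k_meas.comp measurable_snd).enorm.mul
      (measurable_comp_inv_smul F_meas).enorm).aemeasurable

theorem isLocallyFiniteMeasure_map_orbitMap [MeasurableSpace (HaarModel G)]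
    [BorelSpace (HaarModel G)] {μ : Measure X} [SFinite μ]
    [SMulInvariantMeasure G X μ] (F_int : ∫⁻ x, ‖F x‖ₑ ∂μ ≠ ∞) :
    IsLocallyFiniteMeasure (μ.map (orbitMap G F F_meas F_le F_ne)) := by
  refine ⟨fun φ ↦ ?_⟩
  obtain ⟨k, hk⟩ : ∃ k, φ.1.1 k ≠ 0 := by
    by_contra! h
    exact φ.2 (DFunLike.ext _ _ h)
  obtain ⟨ε, ε_pos, hε⟩ := exists_between (enorm_pos.mpr hk)
  have eval_cont := (PuncturedWeakDualBall.continuous_eval k).enorm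
  refine ⟨{ψ | ε < ‖ψ.1.1 k‖ₑ},
    (isOpen_lt continuous_const eval_cont).mem_nhds hε, ?_⟩
  rw [Measure.map_apply (measurable_orbitMap F_meas F_le F_ne)
    (isOpen_lt continuous_const eval_cont).measurableSet]
  have eval_meas := eval_cont.measurable.comp
    (measurable_orbitMap (G := G) F_meas F_le F_ne)
  -- Markov's inequality for the integrable evaluation at `k`.
  refine (measure_mono fun x (hx : ε < _) ↦ hx.le).trans_lt ((meas_ge_le_lintegral_div eval_meas.aemeasurable
    ε_pos.ne' (hε.trans_le le_top).ne).trans_lt (ENNReal.div_lt_top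
      (lintegral_enorm_orbitMap_apply_ne_top F_meas F_le F_ne F_int k) ε_pos.ne'))

end Model

/-! ### Invariance, change of universe, and the main theorem -/

theorem SMulInvariantMeasure.map_of_equivariant {G X Y : Type*} [Group G] [MulAction G X]
    [MulAction G Y] [MeasurableSpace X] [MeasurableSpace Y] [MeasurableConstSMul G Y]
    {μ : Measure X} [SMulInvariantMeasure G X μ] {θ : X → Y} (hθ : Measurable θ)
    (equiv : ∀ (g : G) (x : X), θ (g • x) = g • θ x) : SMulInvariantMeasure G Y (μ.map θ) := by
  refine ⟨fun g s hs ↦ ?_⟩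
  rw [Measure.map_apply hθ (measurable_const_smul g hs), Measure.map_apply hθ hs,
    ← SMulInvariantMeasure.measure_preimage_smul (μ := μ) g (hθ hs)]
  simp only [Set.preimage_preimage, equiv]

/-- The model lives in the universe of `G`, but `Y` is wanted in that of `X`; a Borel embedding into
`ℝ` allows the move. -/
theorem small_of_polishSpace (Y : Type*) [TopologicalSpace Y] [PolishSpace Y] : Small.{u} Y := by
  borelize Y
  exact small_of_injective (measurableEmbedding_embeddingReal Y).injective

theorem theoremB {G : Type*} [Group G] [TopologicalSpace G] [IsTopologicalGroup G]
    [PolishSpace G] [LocallyCompactSpace G] [MeasurableSpace G] [BorelSpace G]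
    {X : Type u} [MeasurableSpace X] [StandardBorelSpace X]
    (μ : Measure X) [SigmaFinite μ]
    [MulAction G X] [MeasurableSMul₂ G X] [SMulInvariantMeasure G X μ] :
    ∃ (Y : Type u) (_ : TopologicalSpace Y) (_ : PolishSpace Y) (_ : LocallyCompactSpace Y)
      (_ : MeasurableSpace Y) (_ : BorelSpace Y) (_ : MulAction G Y) (_ : ContinuousSMul G Y)
      (θ : X → Y),
      Measurable θ ∧ Function.Injective θ ∧ (∀ (g : G) (x : X), θ (g • x) = g • θ x) ∧
        (μ.map θ).Regular ∧ SMulInvariantMeasure G Y (μ.map θ) := by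
  obtain ⟨F, F_meas, F_inj, F_ne, F_le, F_int⟩ := exists_injective_integrable_ne_zero μ
  borelize (HaarModel G)
  have : Small.{u} (HaarModel G) := small_of_polishSpace _
  let e : Shrink.{u} (HaarModel G) ≃ₜ HaarModel G := (Shrink.homeomorph _).symm
  borelize (Shrink.{u} (HaarModel G))
  have smul_def (g : G) (y : Shrink.{u} (HaarModel G)) : g • y = e.symm (g • e y) := rfl
  have : ContinuousSMul G (Shrink.{u} (HaarModel G)) := ⟨e.symm.continuous.comp
    (continuous_fst.smul (e.continuous.comp continuous_snd))⟩
  have : PolishSpace (Shrink.{u} (HaarModel G)) := e.isClosedEmbedding.polishSpace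
  have : LocallyCompactSpace (Shrink.{u} (HaarModel G)) := e.isClosedEmbedding.locallyCompactSpace
  have θ_meas := measurable_orbitMap (G := G) F_meas F_le F_ne
  have eθ_meas := e.symm.continuous.measurable.comp θ_meas
  have equivariant (g : G) (x : X) : e.symm (orbitMap G F F_meas F_le F_ne (g • x)) =
      g • e.symm (orbitMap G F F_meas F_le F_ne x) := by
    rw [orbitMap_smul, smul_def, e.apply_symm_apply]
  have := isLocallyFiniteMeasure_map_orbitMap (G := G) F_meas F_le F_ne F_int
  refine ⟨Shrink.{u} (HaarModel G), inferInstance, inferInstance, inferInstance, inferInstance,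
    inferInstance, inferInstance, inferInstance, e.symm ∘ orbitMap G F F_meas F_le F_ne, eθ_meas,
    e.symm.injective.comp (orbitMap_injective F_meas F_le F_ne F_inj), equivariant, ?_,
    SMulInvariantMeasure.map_of_equivariant eθ_meas equivariant⟩
  -- Local finiteness on a locally compact Polish space already gives regularity, which the
  -- homeomorphism `e.symm` transports.
  rw [← Measure.map_map e.symm.continuous.measurable θ_meas]
  exact Measure.Regular.map e.symm
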